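/- Let $S$ and $B$ be finite sets of states and actions. Let $p^k_{s,\cdot}\in\Delta(S)$ be transition probabilities, $r^k_s\in\mathbb R$ (expected) rewards for $s\in S$, $k\in B$, and $\gamma\in[0,1)$ a discount factor. For each $s\in S$ let $P_s\in\Delta(2^B)$ be a distribution of the set of available actions at $s$, with $P_s(\emptyset)=0$ (an MDP with stochastic action sets, SAS-MDP). The compressed MDP $\mathcal M_c$ has state space $S$ and, as actions at each state, the state policies $\mu:2^B\to B$ with $\mu(A)\in A$ for all $A\ne\emptyset$. Its transition probabilities and rewards are $p^{\mu}_{s,s'}=\sum_{A\subseteq B}P_s(A)\,p^{\mu(A)}_{s,s'}$ and $r^\mu_s=\sum_{A\subseteq B}P_s(A)\,r^{\mu(A)}_s$. Let $V_c^*(s)$ be its optimal value function, i.e. the maximum over policies $(\mu_s)_{s\in S}$ of the expected total $\gamma$-discounted reward from $s$. Its optimal Q-function is $Q^*(s,k)=r^k_s+\gamma\sum_{s'\in S}p^k_{s,s'}V_c^*(s')$ for $s\in S$, $k\in B$. On a probability space with a filtration $(\mathcal F_t)_{t\ge 0}$, let training data $(s_t,A_t,k_t,r_t,s'_t,A'_t)_{t\ge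 0}$ be given with $s_t,s'_t\in S$; $A_t,A'_t\subseteq B$; $k_t\in A_t$ a.s.; and $r_t\in\mathbb R$. Suppose that $s_t,A_t,k_t$ are $\mathcal F_t$-measurable, that $r_t,s'_t,A'_t$ are $\mathcal F_{t+1}$-measurable, that $\mathbb E[r_t\mid\mathcal F_t]=r^{k_t}_{s_t}$ a.s., and that $$\Pr(s'_t=s',\,A'_t=A\mid\mathcal F_t)=p^{k_t}_{s_t,s'}\,P_{s'}(A)\quad\text{a.s. for all } s'\in S,\ A\subseteq B .$$ (A single trajectory is the case $s'_t=s_{t+1}$, $A'_t=A_{t+1}$. The rule by which the actions are chosen is arbitrary.) Let $\alpha_t$ be $\mathcal F_t$-measurable learning rates with $0\le\alpha_t<1$ a.s. Starting from an arbitrary $Q_0:S\times B\to\mathbb R$, SAS-Q-learning sets $$Q_{t+1}(s_t,k_t)=(1-\alpha_t)\,Q_t(s_t,k_t)+\alpha_t\Big[r_t+\gamma\max_{k\in A'_t}Q_t(s'_t,k)\Big]$$ and $Q_{t+1}(s,k)=Q_t(s,k)$ for all $(s,k)\neq(s_t,k_t)$. Theorem. Assume that (a) the rewards are bounded: there is a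 constant $C$ with $|r_t|\le C$ a.s. for all $t$; and (b) for every pair $(s,k)\in S\times B$, almost surely $$\sum_{t:\,(s_t,k_t)=(s,k)}\alpha_t=\infty\qquad\text{and}\qquad\sum_{t:\,(s_t,k_t)=(s,k)}\alpha_t^2<\infty .$$ Then almost surely $Q_t(s,k)\to Q^*(s,k)$ as $t\to\infty$ for all $(s,k)\in S\times B$. -/

import Mathlib

open MeasureTheory Filter Topology
open scoped Matrix

/-- A finite-state, discounted, infinite-horizon Markov decision process: transition probabilities
`p s a s'`, (expected) rewards `r s a` and a discount factor `0 ≤ γ < 1`. -/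
structure MDP (S Act : Type*) [Fintype S] where
  p : S → Act → S → ℝ
  p_mem : ∀ s a, p s a ∈ stdSimplex ℝ S
  r : S → Act → ℝ
  γ : ℝ
  γ_nonneg : 0 ≤ γ
  γ_lt_one : γ < 1

namespace MDP

variable {S Act : Type*} [Fintype S] [DecidableEq S]

/-- The transition matrix of the Markov chain induced by a (stationary, deterministic) policy. -/
def transitionMatrix (M : MDP S Act) (π : S → Act) : Matrix S S ℝ :=
  Matrix.of fun s s' => M.p s (π s) s'

/-- The expected total discounted reward of the policy `π` from the start state `s`:
the reward expected at stage `t` is the `s`-entry of `(P^π) ^ t` applied to `r^π`. -/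
noncomputable def value (M : MDP S Act) (π : S → Act) (s : S) : ℝ :=
  ∑' t : ℕ, M.γ ^ t * ((M.transitionMatrix π ^ t) *ᵥ fun s' => M.r s' (π s')) s

/-- The optimal value function: the best value over all policies. -/
noncomputable def optValue (M : MDP S Act) (s : S) : ℝ :=
  ⨆ π : S → Act, M.value π s

end MDP

/-- An MDP with stochastic action sets: a base MDP with action set `B`, and for each state `s` a
distribution `avail s` over the subsets of `B` that gives the empty set probability `0`. -/
structure SASMDP (S B : Type*) [Fintype S] [Fintype B] extends MDP S B where
  avail : S → Finset B → ℝ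
  avail_mem : ∀ s, avail s ∈ stdSimplex ℝ (Finset B)
  avail_empty : ∀ s, avail s ∅ = 0

/-- State policies: maps from available sets to actions that choose an available action.
(The empty set, which never occurs, is unconstrained.) -/
abbrev StatePolicy (B : Type*) : Type _ :=
  {f : Finset B → B // ∀ A : Finset B, A.Nonempty → f A ∈ A}

namespace SASMDP

variable {S B : Type*} [Fintype S] [Fintype B]

/-- The compressed MDP: its states are the base states, its actions are the state policies, and
its transition probabilities and rewards are expectations over the available set. -/
noncomputable def compressed (M : SASMDP S B) : MDP S (StatePolicy B) where
  p s f s' := ∑ A : Finset B, M.avail s A * M.p s (f.1 A) s'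
  p_mem s f := by
    refine ⟨fun s' => Finset.sum_nonneg fun A _ =>
      mul_nonneg ((M.avail_mem s).1 A) ((M.p_mem s (f.1 A)).1 s'), ?_⟩
    rw [Finset.sum_comm]
    simp_rw [← Finset.mul_sum, (M.p_mem s _).2, mul_one]
    exact (M.avail_mem s).2
  r s f := ∑ A : Finset B, M.avail s A * M.r s (f.1 A)
  γ := M.γ
  γ_nonneg := M.γ_nonneg
  γ_lt_one := M.γ_lt_one

/-- The optimal Q-function of the compressed MDP, on base state-action pairs: execute the base
action `k` at `s`, then behave optimally in the compressed MDP. -/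
noncomputable def optQ [DecidableEq S] (M : SASMDP S B) (s : S) (k : B) : ℝ :=
  M.r s k + M.γ * ∑ s', M.p s k s' * M.compressed.optValue s'

end SASMDP

/-- The maximum of `q` over the finite set `A` (`0` if `A` is empty, a null event below). -/
noncomputable def maxOver {B : Type*} (A : Finset B) (q : B → ℝ) : ℝ :=
  open Classical in if h : A.Nonempty then A.sup' h q else 0

/-- Training data. The `t`-th update uses the tuple of the current state, its available set, the
action taken, the realized reward, the next state and the set available there.
For a single trajectory, `nextState t = state (t + 1)` and `nextAvail t = avail (t + 1)`; leaving
these unlinked also covers several trajectories and other orders of visiting the pairs. -/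
structure SASData (Ω S B : Type*) where
  state : ℕ → Ω → S
  avail : ℕ → Ω → Finset B
  act : ℕ → Ω → B
  reward : ℕ → Ω → ℝ
  nextState : ℕ → Ω → S
  nextAvail : ℕ → Ω → Finset B

/-- The data are generated by the SAS-MDP `M`. Here `ℱ t` is the information available when the
action of step `t` has been chosen (by an arbitrary, possibly history-dependent and randomized
rule). Given `ℱ t`, the realized reward has mean `r s k`, the next state has law `p s k`, and the
next available set has law `avail s'` given the next state `s'`. -/
structure SASData.GeneratedBy {Ω S B : Type*} [Fintype S] [Fintype B] {mΩ : MeasurableSpace Ω}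
    (D : SASData Ω S B) (M : SASMDP S B) (P : Measure Ω) (ℱ : Filtration ℕ mΩ) : Prop where
  measurable_state : ∀ t, Measurable[ℱ t, ⊤] (D.state t)
  measurable_avail : ∀ t, Measurable[ℱ t, ⊤] (D.avail t)
  measurable_act : ∀ t, Measurable[ℱ t, ⊤] (D.act t)
  measurable_reward : ∀ t, Measurable[ℱ (t + 1)] (D.reward t)
  measurable_nextState : ∀ t, Measurable[ℱ (t + 1), ⊤] (D.nextState t)
  measurable_nextAvail : ∀ t, Measurable[ℱ (t + 1), ⊤] (D.nextAvail t)
  act_mem : ∀ t, ∀ᵐ ω ∂P, D.act t ω ∈ D.avail t ω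
  integrable_reward : ∀ t, Integrable (D.reward t) P
  condExp_reward : ∀ t, P[D.reward t | ℱ t] =ᵐ[P] fun ω => M.r (D.state t ω) (D.act t ω)
  condExp_next : ∀ (t : ℕ) (s' : S) (A : Finset B),
    P[Set.indicator {ω | D.nextState t ω = s' ∧ D.nextAvail t ω = A} (fun _ => (1 : ℝ)) | ℱ t]
      =ᵐ[P] fun ω => M.p (D.state t ω) (D.act t ω) s' * M.avail s' A

/-- The SAS-Q-learning iterates, with discount factor `γ`, learning rates `α` and initial estimate
`Q₀`: the entry of the current state-action pair is moved towards the realized reward plus the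
discounted maximum over the realized next available set; all other entries are kept. -/
noncomputable def sasQ {Ω S B : Type*} [DecidableEq S] [DecidableEq B] (γ : ℝ)
    (D : SASData Ω S B) (α : ℕ → Ω → ℝ) (Q₀ : S → B → ℝ) : ℕ → Ω → S → B → ℝ
  | 0, _, s, k => Q₀ s k
  | t + 1, ω, s, k =>
    if s = D.state t ω ∧ k = D.act t ω then
      (1 - α t ω) * sasQ γ D α Q₀ t ω s k
        + α t ω * (D.reward t ω
            + γ * maxOver (D.nextAvail t ω) (sasQ γ D α Q₀ t ω (D.nextState t ω)))
    else sasQ γ D α Q₀ t ω s k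

/-- The learning rate that step `t` applies to the pair `(s, k)`: `α t` if the step updates that
pair, and `0` otherwise. -/
def pairRate {Ω S B : Type*} [DecidableEq S] [DecidableEq B] (D : SASData Ω S B)
    (α : ℕ → Ω → ℝ) (s : S) (k : B) (t : ℕ) (ω : Ω) : ℝ :=
  if s = D.state t ω ∧ k = D.act t ω then α t ω else 0

/-! The optimal Q-function is a fixed point of the Bellman operator `qOp`, a sup-norm contraction
with factor γ. The link with the compressed MDP is that a state policy chooses its action separately
for each available set, so optimising over state policies amounts to taking the maximum inside the
expectation over sets (`optValue_compressed_eq`).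

The sampled backup has conditional mean `qOp` of the current iterate (`condExp_target`). Hence each
coordinate of the error moves, at rate `pairRate`, towards a contracted error plus a martingale
difference. Bounded rewards keep the iterates in a fixed ball, so this noise is bounded;
square-summable rates then make its weighted sums converge almost surely, by L² martingale estimates
and truncation (`ae_exists_tendsto_sum_mul_of_summable_sq`).

The rest is pathwise (`tendsto_zero_of_contraction_add_noise`): adding the tail of the convergent
noise series to the error removes the noise from the recursion, and divergence of the rates turns an
eventual bound c into (1 + γ)/2 · c. Iterating gives convergence to zero. -/

/-! ### Pathwise stochastic approximation -/

/-- Averages with non-summable weights of a sequence that is eventually bounded by `c` are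
eventually bounded by any `d > c`. -/
theorem eventually_abs_le_of_averaging {a y e : ℕ → ℝ} {c d : ℝ}
    (ha : ∀ t, 0 ≤ a t ∧ a t ≤ 1)
    (hsum : Tendsto (fun n => ∑ t ∈ Finset.range n, a t) atTop atTop)
    (hy : ∀ t, y (t + 1) = (1 - a t) * y t + a t * e t)
    (he : ∀ᶠ t in atTop, |e t| ≤ c) (hcd : c < d) : ∀ᶠ t in atTop, |y t| ≤ d := by
  obtain ⟨N, hN⟩ := eventually_atTop.1 he
  set K : ℝ := max (|y N| - c) 0
  have hK : 0 ≤ K := le_max_right _ _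
  -- Each step multiplies the excess over `c` by at most 1 - a ≤ exp(-a). The positive part in `K`
  -- covers a negative initial excess.
  have key : ∀ n, N ≤ n → |y n| - c ≤
      K * Real.exp (∑ t ∈ Finset.range N, a t - ∑ t ∈ Finset.range n, a t) := by
    intro n hn
    induction n, hn using Nat.le_induction with
    | base => simp [K]
    | succ n hn ih =>
      have h1 : |y (n + 1)| ≤ (1 - a n) * |y n| + a n * c := by
        rw [hy n]
        refine (abs_add_le _ _).trans ?_
        rw [abs_mul, abs_mul, abs_of_nonneg (ha n).1, abs_of_nonneg (sub_nonneg.2 (ha n).2)]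
        gcongr
        · exact (ha n).1
        · exact hN n hn
      calc |y (n + 1)| - c ≤ (1 - a n) * (|y n| - c) := by linarith
        _ ≤ (1 - a n) * (K *
            Real.exp (∑ t ∈ Finset.range N, a t - ∑ t ∈ Finset.range n, a t)) :=
          mul_le_mul_of_nonneg_left ih (sub_nonneg.2 (ha n).2)
        _ ≤ Real.exp (-a n) * (K *
            Real.exp (∑ t ∈ Finset.range N, a t - ∑ t ∈ Finset.range n, a t)) := by
          gcongr
          linarith [Real.add_one_le_exp (-a n)]
        _ = _ := by
          rw [mul_left_comm, ← Real.exp_add, Finset.sum_range_succ]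
          ring_nf
  have hlim : Tendsto (fun n =>
      K * Real.exp (∑ t ∈ Finset.range N, a t - ∑ t ∈ Finset.range n, a t)) atTop (𝓝 0) := by
    have h := (Real.tendsto_exp_atBot.comp
      (tendsto_atBot_add_const_left atTop (∑ t ∈ Finset.range N, a t)
        (tendsto_neg_atTop_atBot.comp hsum))).const_mul K
    simpa [Function.comp_def, sub_eq_add_neg] using h
  filter_upwards [hlim.eventually (gt_mem_nhds (sub_pos.2 hcd)), eventually_ge_atTop N]
    with n h1 h2
  linarith [key n h2]

/-- Asynchronous stochastic approximation of a sup-norm contraction, pathwise form: the noise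
enters only through the convergence of its weighted sums. -/
theorem tendsto_zero_of_contraction_add_noise {I : Type*} [Finite I]
    {a x G w : ℕ → I → ℝ} {γ K : ℝ} (hγ : 0 ≤ γ) (hγ1 : γ < 1)
    (ha : ∀ t i, 0 ≤ a t i ∧ a t i ≤ 1)
    (hsum : ∀ i, Tendsto (fun n => ∑ t ∈ Finset.range n, a t i) atTop atTop)
    (hx : ∀ t i, x (t + 1) i = (1 - a t i) * x t i + a t i * (G t i + w t i))
    (hG : ∀ t c, 0 ≤ c → (∀ i, |x t i| ≤ c) → ∀ i, |G t i| ≤ γ * c)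
    (hw : ∀ i, ∃ l, Tendsto (fun n => ∑ t ∈ Finset.range n, a t i * w t i) atTop (𝓝 l))
    (hK : ∀ t i, |x t i| ≤ K) (i : I) : Tendsto (fun t => x t i) atTop (𝓝 0) := by
  have hstep : ∀ c : ℝ, 0 < c → (∀ᶠ t in atTop, ∀ i, |x t i| ≤ c) →
      ∀ᶠ t in atTop, ∀ i, |x t i| ≤ (1 + γ) / 2 * c := by
    intro c hc hev
    rw [eventually_all]
    intro i
    obtain ⟨l, hl⟩ := hw i
    -- Since a w = T t - T (t + 1), the shifted sequence x + T is averaged exactly towards G + T.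
    set T : ℕ → ℝ := fun n => l - ∑ t ∈ Finset.range n, a t i * w t i
    have hT : Tendsto T atTop (𝓝 0) := by simpa [T] using hl.const_sub l
    -- With δ = (1 - γ)c/8, the target is at most γc + δ, then x + T at most γc + 2δ, and x at most
    -- γc + 3δ, below γc + 4δ = (1 + γ)/2 · c.
    have hδ : 0 < (1 - γ) * c / 8 := by have := mul_pos (sub_pos.2 hγ1) hc; linarith
    have hTs : ∀ᶠ t in atTop, |T t| ≤ (1 - γ) * c / 8 := by
      filter_upwards [hT.eventually (Metric.ball_mem_nhds 0 hδ)] with t ht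
      simpa using (le_of_lt ht)
    have hy := eventually_abs_le_of_averaging (a := fun t => a t i) (y := fun t => x t i + T t)
      (e := fun t => G t i + T t) (c := γ * c + (1 - γ) * c / 8)
      (d := γ * c + (1 - γ) * c / 4) (fun t => ha t i) (hsum i)
      (fun t => by simp only [T]; rw [hx t i, Finset.sum_range_succ]; ring)
      (by
        filter_upwards [hev, hTs] with t h1 h2
        exact (abs_add_le _ _).trans (add_le_add (hG t c hc.le h1 i) h2))
      (by linarith)
    filter_upwards [hy, hTs] with t h1 h2
    have h3 : |x t i| ≤ |x t i + T t| + |T t| := by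
      simpa using abs_sub (x t i + T t) (T t)
    linarith
  -- The bound starts from `|K| + 1` because `hstep` needs a strictly positive constant.
  have hall : ∀ n : ℕ, ∀ᶠ t in atTop, ∀ i, |x t i| ≤ ((1 + γ) / 2) ^ n * (|K| + 1) := by
    intro n
    induction n with
    | zero =>
      exact Eventually.of_forall fun t i => by
        simpa using (hK t i).trans ((le_abs_self K).trans (by linarith))
    | succ n ih =>
      have := hstep _ (by positivity) ih
      simpa [pow_succ', mul_assoc] using this
  have hlim : Tendsto (fun n : ℕ => ((1 + γ) / 2) ^ n * (|K| + 1)) atTop (𝓝 0) := by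
    simpa using (tendsto_pow_atTop_nhds_zero_of_lt_one (by linarith : 0 ≤ (1 + γ) / 2)
      (by linarith)).mul_const (|K| + 1)
  rw [Metric.tendsto_nhds]
  intro ε hε
  obtain ⟨n, hn⟩ := (hlim.eventually (gt_mem_nhds hε)).exists
  filter_upwards [hall n] with t ht
  simpa using (ht i).trans_lt hn

/-! ### Discounted MDPs and the Bellman optimality equation -/

namespace MDP

variable {S Act : Type*} [Fintype S]

/-- A vector that dominates its discounted average is nonnegative. -/
theorem nonneg_of_discounted_average_le (M : MDP S Act) (π : S → Act) {d : S → ℝ}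
    (hd : ∀ s, M.γ * ∑ s', M.p s (π s) s' * d s' ≤ d s) (s : S) : 0 ≤ d s := by
  have : Nonempty S := ⟨s⟩
  -- At a minimiser the hypothesis gives γ · d m ≤ d m, and γ < 1 forces d m ≥ 0.
  obtain ⟨m, hm⟩ := Finite.exists_min d
  refine le_trans ?_ (hm s)
  have h1 : d m ≤ ∑ s', M.p m (π m) s' * d s' := by
    calc d m = ∑ s', M.p m (π m) s' * d m := by
          rw [← Finset.sum_mul, (M.p_mem m (π m)).2, one_mul]
      _ ≤ _ := Finset.sum_le_sum fun s' _ =>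
          mul_le_mul_of_nonneg_left (hm s') ((M.p_mem m (π m)).1 s')
  have h2 := mul_le_mul_of_nonneg_left h1 M.γ_nonneg
  nlinarith [hd m, M.γ_lt_one]

variable [DecidableEq S]

theorem abs_transitionMatrix_pow_mulVec_le (M : MDP S Act) (π : S → Act) {v : S → ℝ} {R : ℝ}
    (hv : ∀ s, |v s| ≤ R) (t : ℕ) (s : S) : |((M.transitionMatrix π ^ t) *ᵥ v) s| ≤ R := by
  induction t generalizing s with
  | zero => simpa using hv s
  | succ t ih =>
    rw [pow_succ', ← Matrix.mulVec_mulVec]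
    calc |∑ s', M.p s (π s) s' * ((M.transitionMatrix π ^ t) *ᵥ v) s'|
        ≤ ∑ s', M.p s (π s) s' * R := (Finset.abs_sum_le_sum_abs _ _).trans <|
          Finset.sum_le_sum fun s' _ => by
            rw [abs_mul, abs_of_nonneg ((M.p_mem s (π s)).1 s')]
            exact mul_le_mul_of_nonneg_left (ih s') ((M.p_mem s (π s)).1 s')
      _ = R := by rw [← Finset.sum_mul, (M.p_mem s (π s)).2, one_mul]

theorem summable_value (M : MDP S Act) (π : S → Act) (s : S) :
    Summable fun t : ℕ =>
      M.γ ^ t * ((M.transitionMatrix π ^ t) *ᵥ fun s' => M.r s' (π s')) s := by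
  refine Summable.of_norm_bounded
    ((summable_geometric_of_lt_one M.γ_nonneg M.γ_lt_one).mul_right
      ‖fun s' => M.r s' (π s')‖) fun t => ?_
  rw [norm_mul, norm_pow, Real.norm_of_nonneg M.γ_nonneg]
  exact mul_le_mul_of_nonneg_left (M.abs_transitionMatrix_pow_mulVec_le π
    (norm_le_pi_norm fun s' => M.r s' (π s')) t s) (pow_nonneg M.γ_nonneg t)

theorem value_eq (M : MDP S Act) (π : S → Act) (s : S) :
    M.value π s = M.r s (π s) + M.γ * ∑ s', M.p s (π s) s' * M.value π s' := by
  rw [value, (M.summable_value π s).tsum_eq_zero_add]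
  congr 1
  · simp
  · simp only [value, ← tsum_mul_left]
    rw [← Summable.tsum_finsetSum fun s' _ => (M.summable_value π s').mul_left _, ← tsum_mul_left]
    refine tsum_congr fun t => ?_
    rw [pow_succ' (M.transitionMatrix π), ← Matrix.mulVec_mulVec]
    change _ * ∑ s', M.p s (π s) s' * _ = _
    rw [Finset.mul_sum, Finset.mul_sum]
    exact Finset.sum_congr rfl fun s' _ => by ring

/-- A solution of the Bellman optimality equation is the optimal value function. -/
theorem optValue_eq_of_bellman (M : MDP S Act) {V : S → ℝ}
    (hle : ∀ s a, M.r s a + M.γ * ∑ s', M.p s a s' * V s' ≤ V s)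
    (heq : ∀ s, ∃ a, M.r s a + M.γ * ∑ s', M.p s a s' * V s' = V s) (s : S) :
    M.optValue s = V s := by
  -- For every policy, V minus its value dominates its own discounted average; for a policy
  -- attaining equality in `heq` the same holds with the sign reversed.
  have hub : ∀ π s, M.value π s ≤ V s := fun π s => by
    refine sub_nonneg.1 (M.nonneg_of_discounted_average_le π (d := fun s => V s - M.value π s)
      (fun s => ?_) s)
    simp only [mul_sub, Finset.sum_sub_distrib]
    linarith [hle s (π s), M.value_eq π s]
  choose π hπ using heq
  have : Nonempty (S → Act) := ⟨π⟩
  refine le_antisymm (ciSup_le fun π => hub π s) (le_trans ?_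
    (le_ciSup (f := fun π => M.value π s) ⟨V s, Set.forall_mem_range.2 fun π => hub π s⟩ π))
  refine sub_nonneg.1 (M.nonneg_of_discounted_average_le π (d := fun s => M.value π s - V s)
    (fun s => ?_) s)
  simp only [mul_sub, Finset.sum_sub_distrib]
  linarith [hπ s, M.value_eq π s]

end MDP

/-! ### Maxima over available sets -/

theorem maxOver_of_nonempty {B : Type*} {A : Finset B} (hA : A.Nonempty) (q : B → ℝ) :
    maxOver A q = A.sup' hA q := dif_pos hA

theorem maxOver_empty {B : Type*} (q : B → ℝ) : maxOver ∅ q = 0 := dif_neg (by simp)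

/-- The maximum is monotone and commutes with adding constants. The sign of `c` matters only for the
empty set, where both maxima are 0. -/
theorem maxOver_le_add {B : Type*} {A : Finset B} {q q' : B → ℝ} {c : ℝ} (hc : 0 ≤ c)
    (h : ∀ k, q k ≤ q' k + c) : maxOver A q ≤ maxOver A q' + c := by
  rcases A.eq_empty_or_nonempty with rfl | hA
  · simpa [maxOver_empty] using hc
  · rw [maxOver_of_nonempty hA, maxOver_of_nonempty hA]
    exact Finset.sup'_le _ _ fun k hk => (h k).trans (by gcongr; exact Finset.le_sup' q' hk)

theorem abs_maxOver_sub_le {B : Type*} (A : Finset B) {q q' : B → ℝ} {c : ℝ} (hc : 0 ≤ c)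
    (h : ∀ k, |q k - q' k| ≤ c) : |maxOver A q - maxOver A q'| ≤ c := by
  rw [abs_sub_le_iff]
  constructor
  · linarith [maxOver_le_add (A := A) (q := q) (q' := q') hc
      fun k => by linarith [(abs_sub_le_iff.1 (h k)).1]]
  · linarith [maxOver_le_add (A := A) (q := q') (q' := q) hc
      fun k => by linarith [(abs_sub_le_iff.1 (h k)).2]]

theorem abs_maxOver_le {B : Type*} (A : Finset B) {q : B → ℝ} {c : ℝ} (hc : 0 ≤ c)
    (h : ∀ k, |q k| ≤ c) : |maxOver A q| ≤ c := by
  have h0 : maxOver A (fun _ => (0 : ℝ)) = 0 := by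
    rcases A.eq_empty_or_nonempty with rfl | hA
    · exact maxOver_empty _
    · rw [maxOver_of_nonempty hA, Finset.sup'_const]
  simpa [h0] using abs_maxOver_sub_le A (q := q) (q' := fun _ => 0) hc (by simpa using h)

/-- A finite average of numbers of absolute value at most `c` has absolute value at most `c`. -/
theorem abs_sum_mul_le_of_mem_stdSimplex {ι : Type*} [Fintype ι] {p v : ι → ℝ} {c : ℝ}
    (hp : p ∈ stdSimplex ℝ ι) (hv : ∀ i, |v i| ≤ c) : |∑ i, p i * v i| ≤ c :=
  calc |∑ i, p i * v i| ≤ ∑ i, p i * c := (Finset.abs_sum_le_sum_abs _ _).trans <|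
        Finset.sum_le_sum fun i _ => by
          rw [abs_mul, abs_of_nonneg (hp.1 i)]
          exact mul_le_mul_of_nonneg_left (hv i) (hp.1 i)
    _ = c := by rw [← Finset.sum_mul, hp.2, one_mul]

/-! ### The Bellman operator on Q-functions and the compressed MDP -/

namespace SASMDP

variable {S B : Type*} [Fintype S] [Fintype B]

/-- The expected maximum of `q` over the random available set at `s`. -/
noncomputable def expMax (M : SASMDP S B) (s : S) (q : B → ℝ) : ℝ :=
  ∑ A, M.avail s A * maxOver A q

/-- The Bellman operator on Q-functions. -/
noncomputable def qOp (M : SASMDP S B) (Q : S → B → ℝ) (s : S) (k : B) : ℝ :=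
  M.r s k + M.γ * ∑ s', M.p s k s' * M.expMax s' (Q s')

theorem abs_expMax_le (M : SASMDP S B) (s : S) {q : B → ℝ} {c : ℝ} (hc : 0 ≤ c)
    (h : ∀ k, |q k| ≤ c) : |M.expMax s q| ≤ c :=
  abs_sum_mul_le_of_mem_stdSimplex (M.avail_mem s) fun A => abs_maxOver_le A hc h

/-- Maxima are 1-Lipschitz and averaging over sets and successor states preserves this, so only the
factor γ remains. -/
theorem abs_qOp_sub_le (M : SASMDP S B) {Q Q' : S → B → ℝ} {c : ℝ} (hc : 0 ≤ c)
    (h : ∀ s k, |Q s k - Q' s k| ≤ c) (s : S) (k : B) :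
    |M.qOp Q s k - M.qOp Q' s k| ≤ M.γ * c := by
  have h1 : ∀ s', |M.expMax s' (Q s') - M.expMax s' (Q' s')| ≤ c := fun s' => by
    simp only [expMax, ← Finset.sum_sub_distrib, ← mul_sub]
    exact abs_sum_mul_le_of_mem_stdSimplex (M.avail_mem s')
      fun A => abs_maxOver_sub_le A hc (h s')
  have h2 := abs_sum_mul_le_of_mem_stdSimplex (M.p_mem s k) h1
  simp only [mul_sub, Finset.sum_sub_distrib] at h2
  rw [qOp, qOp, add_sub_add_left_eq_sub, ← mul_sub, abs_mul, abs_of_nonneg M.γ_nonneg]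
  exact mul_le_mul_of_nonneg_left h2 M.γ_nonneg

theorem exists_qOp_eq_self (M : SASMDP S B) : ∃ Q, M.qOp Q = Q := by
  have hc : ContractingWith ⟨M.γ, M.γ_nonneg⟩ M.qOp := by
    refine ⟨M.γ_lt_one, LipschitzWith.of_dist_le_mul fun Q Q' => ?_⟩
    have h := M.abs_qOp_sub_le (Q := Q) (Q' := Q') dist_nonneg fun s k =>
      (dist_le_pi_dist (Q s) (Q' s) k).trans (dist_le_pi_dist Q Q' s)
    have h0 : 0 ≤ M.γ * dist Q Q' := mul_nonneg M.γ_nonneg dist_nonneg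
    exact (dist_pi_le_iff h0).2 fun s => (dist_pi_le_iff h0).2 fun k => h s k
  exact ⟨_, hc.fixedPoint_isFixedPt⟩

theorem nonempty_action (M : SASMDP S B) (s : S) : Nonempty B := by
  by_contra hB
  rw [not_nonempty_iff] at hB
  have h1 := (M.avail_mem s).2
  rw [Finset.sum_eq_zero fun A _ => by rw [Finset.eq_empty_of_isEmpty A, M.avail_empty]] at h1
  exact zero_ne_one h1

/-- Being an average over available sets, the backup can be optimised for each set separately. -/
theorem compressed_backup (M : SASMDP S B) (s : S) (f : StatePolicy B) (V : S → ℝ) :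
    M.compressed.r s f + M.compressed.γ * ∑ s', M.compressed.p s f s' * V s' =
      ∑ A, M.avail s A * (M.r s (f.1 A) + M.γ * ∑ s', M.p s (f.1 A) s' * V s') := by
  simp only [compressed, mul_add, Finset.sum_add_distrib, Finset.sum_mul, Finset.mul_sum]
  congr 1
  rw [Finset.sum_comm]
  exact Finset.sum_congr rfl fun _ _ => Finset.sum_congr rfl fun _ _ => by ring

/-- The expected maximum of a fixed point of the Bellman operator is the optimal value function
of the compressed MDP. -/
theorem optValue_compressed_eq [DecidableEq S] (M : SASMDP S B) {Q : S → B → ℝ}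
    (hQ : M.qOp Q = Q) (s : S) : M.compressed.optValue s = M.expMax s (Q s) := by
  classical
  have hQ' : ∀ s k, M.r s k + M.γ * ∑ s', M.p s k s' * M.expMax s' (Q s') = Q s k :=
    fun s k => congrFun (congrFun hQ s) k
  refine M.compressed.optValue_eq_of_bellman (V := fun s => M.expMax s (Q s))
    (fun s f => ?_) (fun s => ?_) s
  · rw [compressed_backup]
    simp only [hQ']
    refine Finset.sum_le_sum fun A _ => ?_
    rcases A.eq_empty_or_nonempty with rfl | hA
    · simp [M.avail_empty]
    · rw [maxOver_of_nonempty hA]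
      exact mul_le_mul_of_nonneg_left (Finset.le_sup' (Q s) (f.2 A hA)) ((M.avail_mem s).1 A)
  · obtain ⟨k₀⟩ := M.nonempty_action s
    have hex : ∀ A : Finset B, ∃ k, A.Nonempty → k ∈ A ∧ maxOver A (Q s) = Q s k := fun A => by
      rcases A.eq_empty_or_nonempty with rfl | hA
      · exact ⟨k₀, by simp⟩
      · obtain ⟨k, hk, hk'⟩ := Finset.exists_mem_eq_sup' hA (Q s)
        exact ⟨k, fun _ => ⟨hk, (maxOver_of_nonempty hA _).trans hk'⟩⟩
    choose f hf using hex
    refine ⟨⟨f, fun A hA => (hf A hA).1⟩, ?_⟩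
    rw [compressed_backup]
    simp only [hQ']
    refine Finset.sum_congr rfl fun A _ => ?_
    rcases A.eq_empty_or_nonempty with rfl | hA
    · simp [M.avail_empty]
    · rw [(hf A hA).2]

/-- Inserting V = `expMax` of a fixed point into the definition of `optQ` reproduces `qOp` of that
fixed point. -/
theorem qOp_optQ [DecidableEq S] (M : SASMDP S B) : M.qOp M.optQ = M.optQ := by
  obtain ⟨Q, hQ⟩ := M.exists_qOp_eq_self
  have h : M.optQ = Q := by
    rw [← hQ]
    funext s k
    simp only [optQ, qOp, M.optValue_compressed_eq hQ]
  rw [h, hQ]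

end SASMDP

/-! ### Almost sure convergence of weighted noise sums -/

section Martingale

variable {Ω : Type*} {mΩ : MeasurableSpace Ω} {P : Measure Ω} [IsProbabilityMeasure P]
  {ℱ : Filtration ℕ mΩ}

theorem integrable_of_ae_abs_le {f : Ω → ℝ} (hf : Measurable f) {K : ℝ}
    (hK : ∀ᵐ ω ∂P, |f ω| ≤ K) : Integrable f P :=
  Integrable.of_bound hf.aestronglyMeasurable K hK

/-- A weighted sum of bounded martingale differences converges almost surely if the squares of the
predictable weights have a bounded sum. -/
theorem ae_exists_tendsto_sum_mul_of_sum_sq_le {a w : ℕ → Ω → ℝ} {K N : ℝ}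
    (ha : ∀ t, Measurable[ℱ t] (a t)) (hw : ∀ t, Measurable[ℱ (t + 1)] (w t))
    (hK : ∀ t, ∀ᵐ ω ∂P, |w t ω| ≤ K) (hw0 : ∀ t, P[w t | ℱ t] =ᵐ[P] 0)
    (ha1 : ∀ t ω, |a t ω| ≤ 1)
    (hN : ∀ n ω, ∑ t ∈ Finset.range n, a t ω ^ 2 ≤ N) :
    ∀ᵐ ω ∂P, ∃ l, Tendsto (fun n => ∑ t ∈ Finset.range n, a t ω * w t ω) atTop (𝓝 l) := by
  set f : ℕ → Ω → ℝ := fun n ω => ∑ t ∈ Finset.range n, a t ω * w t ω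
  have hfm : ∀ n, Measurable[ℱ n] (f n) := fun n =>
    Finset.measurable_fun_sum _ fun t ht =>
      ((ha t).mono (ℱ.mono (Finset.mem_range.1 ht).le) le_rfl).mul
        ((hw t).mono (ℱ.mono (Finset.mem_range.1 ht)) le_rfl)
  have ha' : ∀ t, Measurable (a t) := fun t => (ha t).mono (ℱ.le _) le_rfl
  have hw' : ∀ t, Measurable (w t) := fun t => (hw t).mono (ℱ.le _) le_rfl
  have hfm' : ∀ n, Measurable (f n) := fun n => (hfm n).mono (ℱ.le _) le_rfl
  have hfb : ∀ n, ∀ᵐ ω ∂P, |f n ω| ≤ n * K := fun n => by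
    filter_upwards [ae_all_iff.2 hK] with ω hω
    calc |f n ω| ≤ ∑ t ∈ Finset.range n, K := (Finset.abs_sum_le_sum_abs _ _).trans <|
          Finset.sum_le_sum fun t _ => by
            rw [abs_mul]
            exact (mul_le_of_le_one_left (abs_nonneg _) (ha1 t ω)).trans (hω t)
      _ = n * K := by simp
  have hwi : ∀ t, Integrable (w t) P := fun t => integrable_of_ae_abs_le (hw' t) (hK t)
  have hfi : ∀ n, Integrable (f n) P := fun n => integrable_of_ae_abs_le (hfm' n) (hfb n)
  -- Serves twice: with g = a for the martingale property, and with g = f a for the vanishing cross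
  -- term in the second moment.
  have hpull : ∀ (t : ℕ) (g : Ω → ℝ) (L : ℝ), Measurable[ℱ t] g → (∀ᵐ ω ∂P, |g ω| ≤ L) →
      Integrable (g * w t) P ∧ P[g * w t | ℱ t] =ᵐ[P] 0 := fun t g L hg hL => by
    have hi : Integrable (g * w t) P :=
      (hwi t).bdd_mul (hg.mono (ℱ.le _) le_rfl).aestronglyMeasurable hL
    refine ⟨hi, (condExp_mul_of_stronglyMeasurable_left hg.stronglyMeasurable hi (hwi t)).trans ?_⟩
    filter_upwards [hw0 t] with ω hω
    simp [hω]
  have hmart : Martingale f ℱ P := by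
    refine martingale_of_condExp_sub_eq_zero_nat (fun n => (hfm n).stronglyMeasurable) hfi
      fun n => ?_
    have : f (n + 1) - f n = a n * w n := by
      ext ω
      simp [f, Finset.sum_range_succ]
    rw [this]
    exact (hpull n (a n) 1 (ha n) (Eventually.of_forall (ha1 n))).2
  have hsqi : ∀ n, Integrable (fun ω => f n ω ^ 2) P := fun n =>
    integrable_of_ae_abs_le ((hfm' n).pow_const 2) (K := (n * K) ^ 2) <| by
      filter_upwards [hfb n] with ω hω
      rw [abs_pow]
      gcongr
  have hai : ∀ t, Integrable (fun ω => a t ω ^ 2) P := fun t =>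
    integrable_of_ae_abs_le ((ha' t).pow_const 2) (K := 1) <| Eventually.of_forall fun ω => by
      rw [abs_pow]
      exact pow_le_one₀ (abs_nonneg _) (ha1 t ω)
  have hL2 : ∀ n, ∫ ω, f n ω ^ 2 ∂P ≤ K ^ 2 * ∑ t ∈ Finset.range n, ∫ ω, a t ω ^ 2 ∂P := by
    intro n
    induction n with
    | zero => simp [f]
    | succ n ih =>
      obtain ⟨hci, hc0⟩ := hpull n (f n * a n) (n * K) ((hfm n).mul (ha n)) <| by
        filter_upwards [hfb n] with ω hω
        rw [Pi.mul_apply, abs_mul]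
        exact (mul_le_of_le_one_right (abs_nonneg _) (ha1 n ω)).trans hω
      have hcross : ∫ ω, (f n * a n * w n) ω ∂P = 0 := by
        rw [← integral_condExp (ℱ.le n), integral_congr_ae hc0]
        simp
      have hadd : Integrable (fun ω => f n ω ^ 2 + 2 * (f n * a n * w n) ω) P :=
        (hsqi n).add (hci.const_mul 2)
      have hle : ∫ ω, f (n + 1) ω ^ 2 ∂P ≤
          ∫ ω, (f n ω ^ 2 + 2 * (f n * a n * w n) ω + K ^ 2 * a n ω ^ 2) ∂P := by
        refine integral_mono_ae (hsqi _)
          (hadd.add ((hai n).const_mul (K ^ 2))) ?_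
        filter_upwards [hK n] with ω hω
        have h1 : w n ω ^ 2 ≤ K ^ 2 := sq_le_sq' (abs_le.1 hω).1 (abs_le.1 hω).2
        have h2 := mul_le_mul_of_nonneg_right h1 (sq_nonneg (a n ω))
        simp only [f, Finset.sum_range_succ, Pi.mul_apply]
        nlinarith
      rw [integral_add hadd ((hai n).const_mul (K ^ 2)),
        integral_add (hsqi n) (hci.const_mul 2), integral_const_mul, integral_const_mul,
        hcross] at hle
      rw [Finset.sum_range_succ]
      linarith
  -- The inequality |x| ≤ 1 + x² converts the L² bound into the L¹ bound that martingale convergence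
  -- requires.
  have hbound : ∀ n, ∫ ω, |f n ω| ∂P ≤ 1 + K ^ 2 * N := fun n => by
    have h1 : ∫ ω, |f n ω| ∂P ≤ ∫ ω, (1 + f n ω ^ 2) ∂P :=
      integral_mono (hfi n).abs ((integrable_const _).add (hsqi n)) fun ω => by
        change |f n ω| ≤ 1 + f n ω ^ 2
        nlinarith [sq_nonneg (|f n ω| - 1), sq_abs (f n ω), abs_nonneg (f n ω)]
    have h2 : ∑ t ∈ Finset.range n, ∫ ω, a t ω ^ 2 ∂P ≤ N := by
      rw [← integral_finsetSum _ fun t _ => hai t]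
      calc _ ≤ ∫ _, N ∂P := integral_mono (integrable_finsetSum _ fun t _ => hai t)
            (integrable_const _) (hN n)
        _ = N := by simp
    rw [integral_add (integrable_const _) (hsqi n)] at h1
    simp only [integral_const, probReal_univ, smul_eq_mul, mul_one] at h1
    have h3 := mul_le_mul_of_nonneg_left h2 (sq_nonneg K)
    linarith [hL2 n]
  refine hmart.submartingale.exists_ae_tendsto_of_bdd (R := (1 + K ^ 2 * N).toNNReal) fun n => ?_
  rw [eLpNorm_one_eq_lintegral_enorm, ← ofReal_integral_norm_eq_lintegral_enorm (hfi n)]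
  exact ENNReal.ofReal_le_ofReal (hbound n)

/-- A weighted sum of bounded martingale differences converges almost surely if the predictable
weights in `[0, 1]` are almost surely square-summable. -/
theorem ae_exists_tendsto_sum_mul_of_summable_sq {a w : ℕ → Ω → ℝ} {K : ℝ}
    (ha : ∀ t, Measurable[ℱ t] (a t)) (hw : ∀ t, Measurable[ℱ (t + 1)] (w t))
    (hK : ∀ t, ∀ᵐ ω ∂P, |w t ω| ≤ K) (hw0 : ∀ t, P[w t | ℱ t] =ᵐ[P] 0)
    (ha1 : ∀ t, ∀ᵐ ω ∂P, |a t ω| ≤ 1)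
    (hsq : ∀ᵐ ω ∂P, Summable fun t => a t ω ^ 2) :
    ∀ᵐ ω ∂P, ∃ l, Tendsto (fun n => ∑ t ∈ Finset.range n, a t ω * w t ω) atTop (𝓝 l) := by
  classical
  -- Weights are dropped once the accumulated squares exceed N. The sum includes the current weight,
  -- yet the cut stays predictable because `a t` is itself known at time t. Almost every path is
  -- untouched by the cut for some N.
  have htrunc : ∀ N : ℕ, ∀ᵐ ω ∂P, ∃ l, Tendsto (fun n => ∑ t ∈ Finset.range n,
      (if |a t ω| ≤ 1 ∧ ∑ u ∈ Finset.range (t + 1), a u ω ^ 2 ≤ N then a t ω else 0) * w t ω)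
      atTop (𝓝 l) := by
    intro N
    refine ae_exists_tendsto_sum_mul_of_sum_sq_le (ℱ := ℱ) (K := K) (N := N)
      (fun t => ?_) hw hK hw0 (fun t ω => ?_) (fun n ω => ?_)
    · have hs : Measurable[ℱ t] fun ω => ∑ u ∈ Finset.range (t + 1), a u ω ^ 2 :=
        Finset.measurable_fun_sum _ fun u hu => ((ha u).mono
          (ℱ.mono (Nat.lt_succ_iff.1 (Finset.mem_range.1 hu))) le_rfl).pow_const 2
      have habs : Measurable[ℱ t] fun ω => |a t ω| := measurable_norm.comp (ha t)
      exact Measurable.ite (MeasurableSet.inter (measurableSet_le habs measurable_const)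
        (measurableSet_le hs measurable_const)) (ha t) measurable_const
    · split_ifs with h
      · exact h.1
      · simp
    · induction n with
      | zero => simp
      | succ n ih =>
        -- If the last weight is kept, the full untruncated sum is already at most N; otherwise the
        -- truncated sum does not grow.
        by_cases h : |a n ω| ≤ 1 ∧ ∑ u ∈ Finset.range (n + 1), a u ω ^ 2 ≤ N
        · refine (Finset.sum_le_sum fun t _ => ?_).trans h.2
          split_ifs
          · exact le_rfl
          · simpa using sq_nonneg (a t ω)
        · rw [Finset.sum_range_succ, if_neg h]
          simpa using ih
  filter_upwards [ae_all_iff.2 htrunc, ae_all_iff.2 ha1, hsq] with ω h1 h2 h3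
  obtain ⟨N, hN⟩ := exists_nat_ge (∑' t, a t ω ^ 2)
  obtain ⟨l, hl⟩ := h1 N
  refine ⟨l, hl.congr fun n => Finset.sum_congr rfl fun t _ => ?_⟩
  rw [if_pos ⟨h2 t, (h3.sum_le_tsum _ fun _ _ => sq_nonneg _).trans hN⟩]

end Martingale

/-! ### Measurability of finitely indexed selections and maxima -/

section Measurability

theorem measurable_finite_select {Ω ι : Type*} [Finite ι] {m : MeasurableSpace Ω} {g : Ω → ι}
    (hg : Measurable[m, ⊤] g) {F : ι → Ω → ℝ} (hF : ∀ i, Measurable[m] (F i)) :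
    Measurable[m] fun ω => F (g ω) ω := by
  classical
  have := Fintype.ofFinite ι
  have h : (fun ω => F (g ω) ω) = fun ω => ∑ i, if g ω = i then F i ω else 0 := by
    ext ω
    simp
  rw [h]
  exact Finset.measurable_fun_sum _ fun i _ =>
    Measurable.ite (hg (MeasurableSpace.measurableSet_top (s := {i}))) (hF i) measurable_const

theorem measurable_maxOver {Ω B : Type*} {m : MeasurableSpace Ω} (A : Finset B) {q : Ω → B → ℝ}
    (hq : ∀ k, Measurable[m] fun ω => q ω k) : Measurable[m] fun ω => maxOver A (q ω) := by
  rcases A.eq_empty_or_nonempty with rfl | hA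
  · simp only [maxOver_empty]
    exact measurable_const
  · simp only [maxOver_of_nonempty hA]
    convert Finset.measurable_sup' hA (f := fun k ω => q ω k) fun k _ => hq k using 1
    ext ω
    rw [Finset.sup'_apply]

theorem SASMDP.measurable_qOp {Ω S B : Type*} [Fintype S] [Fintype B] {m : MeasurableSpace Ω}
    (M : SASMDP S B) {Q : Ω → S → B → ℝ} (hQ : ∀ s k, Measurable[m] fun ω => Q ω s k)
    (s : S) (k : B) : Measurable[m] fun ω => M.qOp (Q ω) s k :=
  measurable_const.add <| measurable_const.mul <| Finset.measurable_fun_sum _ fun s' _ =>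
    measurable_const.mul <| Finset.measurable_fun_sum _ fun A _ =>
      measurable_const.mul (measurable_maxOver A (hQ s'))

end Measurability

/-! ### Sampled backups and the iterates -/

section Learning

variable {S B Ω : Type*} {mΩ : MeasurableSpace Ω} {P : Measure Ω} {ℱ : Filtration ℕ mΩ}

/-- The sampled Bellman backup of `Q` at step `t`. -/
noncomputable def SASData.target (D : SASData Ω S B) (γ : ℝ) (t : ℕ) (Q : Ω → S → B → ℝ)
    (ω : Ω) : ℝ :=
  D.reward t ω + γ * maxOver (D.nextAvail t ω) (Q ω (D.nextState t ω))

namespace SASData.GeneratedBy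

variable [Fintype S] [Fintype B] {D : SASData Ω S B} {M : SASMDP S B}

theorem measurable_maxOver_next (hD : D.GeneratedBy M P ℱ) {t : ℕ} {Q : Ω → S → B → ℝ}
    (hQ : ∀ s k, Measurable[ℱ (t + 1)] fun ω => Q ω s k) :
    Measurable[ℱ (t + 1)] fun ω => maxOver (D.nextAvail t ω) (Q ω (D.nextState t ω)) :=
  measurable_finite_select (hD.measurable_nextAvail t) fun A =>
    measurable_finite_select (hD.measurable_nextState t)
      (F := fun s ω => maxOver A (Q ω s)) fun s => measurable_maxOver A (hQ s)

theorem measurable_target (hD : D.GeneratedBy M P ℱ) {γ : ℝ} {t : ℕ} {Q : Ω → S → B → ℝ}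
    (hQ : ∀ s k, Measurable[ℱ (t + 1)] fun ω => Q ω s k) :
    Measurable[ℱ (t + 1)] (D.target γ t Q) :=
  (hD.measurable_reward t).add (measurable_const.mul (hD.measurable_maxOver_next hQ))

theorem measurable_qOp_current (hD : D.GeneratedBy M P ℱ) {t : ℕ} {Q : Ω → S → B → ℝ}
    (hQ : ∀ s k, Measurable[ℱ t] fun ω => Q ω s k) :
    Measurable[ℱ t] fun ω => M.qOp (Q ω) (D.state t ω) (D.act t ω) :=
  measurable_finite_select (hD.measurable_act t)
    (F := fun k ω => M.qOp (Q ω) (D.state t ω) k) fun k =>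
    measurable_finite_select (hD.measurable_state t)
      (F := fun s ω => M.qOp (Q ω) s k) fun s => M.measurable_qOp hQ s k

/-- The conditional mean of the sampled Bellman backup is the Bellman operator. -/
theorem condExp_target [IsProbabilityMeasure P] (hD : D.GeneratedBy M P ℱ) {t : ℕ}
    {Q : Ω → S → B → ℝ} (hQ : ∀ s k, Measurable[ℱ t] fun ω => Q ω s k) {K : ℝ} (hK0 : 0 ≤ K)
    (hK : ∀ᵐ ω ∂P, ∀ s k, |Q ω s k| ≤ K) :
    P[D.target M.γ t Q | ℱ t] =ᵐ[P]
      fun ω => M.qOp (Q ω) (D.state t ω) (D.act t ω) := by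
  classical
  set χ : S × Finset B → Ω → ℝ := fun x =>
    Set.indicator {ω | D.nextState t ω = x.1 ∧ D.nextAvail t ω = x.2} fun _ => 1
  set g : S × Finset B → Ω → ℝ := fun x ω => maxOver x.2 (Q ω x.1)
  have hg : ∀ x, Measurable[ℱ t] (g x) := fun x => measurable_maxOver x.2 (hQ x.1)
  have hset : ∀ x : S × Finset B,
      MeasurableSet {ω | D.nextState t ω = x.1 ∧ D.nextAvail t ω = x.2} := fun x =>
    ℱ.le (t + 1) _ (MeasurableSet.inter
      (hD.measurable_nextState t (MeasurableSpace.measurableSet_top (s := {x.1})))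
      (hD.measurable_nextAvail t (MeasurableSpace.measurableSet_top (s := {x.2}))))
  have hχi : ∀ x, Integrable (χ x) P := fun x => (integrable_const 1).indicator (hset x)
  have hgχi : ∀ x, Integrable (g x * χ x) P := fun x =>
    (hχi x).bdd_mul ((hg x).mono (ℱ.le _) le_rfl).aestronglyMeasurable (c := K) <| by
      filter_upwards [hK] with ω hω using abs_maxOver_le x.2 hK0 (hω x.1)
  -- Splitting by the next state and set leaves coefficients known at time t times indicators, whose
  -- conditional means are prescribed by `condExp_next`.
  have hsum : D.target M.γ t Q = D.reward t + M.γ • ∑ x, g x * χ x := by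
    ext ω
    simp only [SASData.target, Pi.add_apply, Pi.smul_apply, Finset.sum_apply, Pi.mul_apply,
      smul_eq_mul]
    congr 2
    rw [Finset.sum_eq_single (D.nextState t ω, D.nextAvail t ω)]
    · simp [g, χ]
    · rintro ⟨s, A⟩ - hne
      have : ω ∉ {ω | D.nextState t ω = s ∧ D.nextAvail t ω = A} := fun h =>
        hne (Prod.ext h.1.symm h.2.symm)
      simp only [χ, Set.indicator_of_notMem this, mul_zero]
    · simp
  have hcond : ∀ x, P[g x * χ x | ℱ t] =ᵐ[P]
      fun ω => g x ω * (M.p (D.state t ω) (D.act t ω) x.1 * M.avail x.1 x.2) := fun x => by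
    filter_upwards [condExp_mul_of_stronglyMeasurable_left (hg x).stronglyMeasurable (hgχi x)
      (hχi x), hD.condExp_next t x.1 x.2] with ω h1 h2
    rw [h1, Pi.mul_apply, h2]
  rw [hsum]
  filter_upwards [condExp_add (hD.integrable_reward t)
      ((integrable_finsetSum' Finset.univ fun x _ => hgχi x).smul M.γ) (ℱ t),
    condExp_smul (μ := P) M.γ (∑ x, g x * χ x) (ℱ t),
    condExp_finsetSum (fun x (_ : x ∈ Finset.univ) => hgχi x) (ℱ t),
    hD.condExp_reward t, ae_all_iff.2 hcond] with ω h1 h2 h3 h4 h5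
  rw [h1, Pi.add_apply, h2, Pi.smul_apply, h3, h4, Finset.sum_apply,
    Finset.sum_congr rfl fun x _ => h5 x, Fintype.sum_prod_type, SASMDP.qOp, smul_eq_mul]
  congr 2
  refine Finset.sum_congr rfl fun s' _ => ?_
  rw [SASMDP.expMax, Finset.mul_sum]
  exact Finset.sum_congr rfl fun A _ => by simp only [g]; ring

end SASData.GeneratedBy

theorem abs_target_le {D : SASData Ω S B} {γ C K : ℝ} (hγ : 0 ≤ γ) (hK0 : 0 ≤ K)
    (hCK : C + γ * K ≤ K) {t : ℕ} {Q : Ω → S → B → ℝ} {ω : Ω} (hr : |D.reward t ω| ≤ C)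
    (hQ : ∀ s k, |Q ω s k| ≤ K) : |D.target γ t Q ω| ≤ K := by
  refine (abs_add_le _ _).trans (le_trans (add_le_add hr ?_) hCK)
  rw [abs_mul, abs_of_nonneg hγ]
  exact mul_le_mul_of_nonneg_left (abs_maxOver_le _ hK0 (hQ _)) hγ

variable [DecidableEq S] [DecidableEq B]

/-- Rate 0 off the visited pair puts all coordinates under one recursion, so asynchrony is absorbed
into the weights. -/
theorem sasQ_succ (γ : ℝ) (D : SASData Ω S B) (α : ℕ → Ω → ℝ) (Q₀ : S → B → ℝ) (t : ℕ) (ω : Ω)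
    (s : S) (k : B) :
    sasQ γ D α Q₀ (t + 1) ω s k = (1 - pairRate D α s k t ω) * sasQ γ D α Q₀ t ω s k +
      pairRate D α s k t ω * D.target γ t (sasQ γ D α Q₀ t) ω := by
  rw [sasQ, pairRate, SASData.target]
  split_ifs with h
  · rfl
  · ring

theorem pairRate_mem {D : SASData Ω S B} {α : ℕ → Ω → ℝ} {t : ℕ} {ω : Ω}
    (h : 0 ≤ α t ω ∧ α t ω ≤ 1) (s : S) (k : B) :
    0 ≤ pairRate D α s k t ω ∧ pairRate D α s k t ω ≤ 1 := by
  rw [pairRate]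
  split_ifs
  · exact h
  · simp

/-- The iterates stay in every sup-norm ball that contains the initial estimate and is preserved
by the sampled backups. -/
theorem abs_sasQ_le {D : SASData Ω S B} {α : ℕ → Ω → ℝ} {Q₀ : S → B → ℝ} {γ C K : ℝ}
    (hγ : 0 ≤ γ) (hK0 : 0 ≤ K) (hCK : C + γ * K ≤ K) (hQ₀ : ∀ s k, |Q₀ s k| ≤ K) {ω : Ω}
    (hr : ∀ t, |D.reward t ω| ≤ C) (hα : ∀ t, 0 ≤ α t ω ∧ α t ω ≤ 1) (t : ℕ) (s : S) (k : B) :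
    |sasQ γ D α Q₀ t ω s k| ≤ K := by
  induction t generalizing s k with
  | zero => exact hQ₀ s k
  | succ t ih =>
    obtain ⟨h0, h1⟩ := pairRate_mem (D := D) (hα t) s k
    have hT := abs_target_le hγ hK0 hCK (hr t) ih
    rw [sasQ_succ]
    refine (abs_add_le _ _).trans ?_
    rw [abs_mul, abs_mul, abs_of_nonneg h0, abs_of_nonneg (sub_nonneg.2 h1)]
    have h2 := mul_le_mul_of_nonneg_left (ih s k) (sub_nonneg.2 h1)
    have h3 := mul_le_mul_of_nonneg_left hT h0
    linarith

variable [Fintype S] [Fintype B] {D : SASData Ω S B} {M : SASMDP S B}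

theorem measurable_pairRate (hD : D.GeneratedBy M P ℱ) {α : ℕ → Ω → ℝ}
    (hα : ∀ t, Measurable[ℱ t] (α t)) (s : S) (k : B) (t : ℕ) :
    Measurable[ℱ t] (pairRate D α s k t) := by
  have h : MeasurableSet[ℱ t] {ω | s = D.state t ω ∧ k = D.act t ω} := by
    simp only [eq_comm (a := s), eq_comm (a := k)]
    exact MeasurableSet.inter
      (hD.measurable_state t (MeasurableSpace.measurableSet_top (s := {s})))
      (hD.measurable_act t (MeasurableSpace.measurableSet_top (s := {k})))
  exact Measurable.ite h (hα t) measurable_const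

theorem measurable_sasQ (hD : D.GeneratedBy M P ℱ) {α : ℕ → Ω → ℝ}
    (hα : ∀ t, Measurable[ℱ t] (α t)) (γ : ℝ) (Q₀ : S → B → ℝ) (t : ℕ) (s : S) (k : B) :
    Measurable[ℱ t] fun ω => sasQ γ D α Q₀ t ω s k := by
  induction t generalizing s k with
  | zero => exact measurable_const
  | succ t ih =>
    have hle := ℱ.mono t.le_succ
    simp only [sasQ_succ]
    have hp := (measurable_pairRate hD hα s k t).mono hle le_rfl
    exact ((measurable_const.sub hp).mul ((ih s k).mono hle le_rfl)).add
      (hp.mul (hD.measurable_target fun s k => (ih s k).mono hle le_rfl))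

end Learning

/-! ### Convergence of SAS-Q-learning -/

theorem mainTheorem9 {S B Ω : Type*} [Fintype S] [DecidableEq S] [Fintype B] [DecidableEq B]
    {mΩ : MeasurableSpace Ω} (P : Measure Ω) [IsProbabilityMeasure P] (ℱ : Filtration ℕ mΩ)
    (M : SASMDP S B) (D : SASData Ω S B) (hD : D.GeneratedBy M P ℱ)
    (hbdd : ∃ C : ℝ, ∀ t, ∀ᵐ ω ∂P, |D.reward t ω| ≤ C)
    (α : ℕ → Ω → ℝ) (hα_meas : ∀ t, Measurable[ℱ t] (α t))
    (hα_range : ∀ t, ∀ᵐ ω ∂P, 0 ≤ α t ω ∧ α t ω < 1)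
    (hα_sum : ∀ s k, ∀ᵐ ω ∂P,
      Tendsto (fun n => ∑ t ∈ Finset.range n, pairRate D α s k t ω) atTop atTop)
    (hα_sq : ∀ s k, ∀ᵐ ω ∂P, Summable (fun t => pairRate D α s k t ω ^ 2))
    (Q₀ : S → B → ℝ) :
    ∀ᵐ ω ∂P, ∀ s k,
      Tendsto (fun t => sasQ M.γ D α Q₀ t ω s k) atTop (𝓝 (M.optQ s k)) := by
  obtain ⟨C, hC⟩ := hbdd
  have hγ := M.γ_nonneg
  have hγ1 : 0 < 1 - M.γ := sub_pos.2 M.γ_lt_one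
  -- C/(1 - γ) is the least radius preserved by a backup with rewards bounded by C; the ball must
  -- also contain `Q₀`.
  obtain ⟨K, hK0, hCK, hQ₀⟩ : ∃ K : ℝ, 0 ≤ K ∧ C + M.γ * K ≤ K ∧ ∀ s k, |Q₀ s k| ≤ K := by
    refine ⟨max ‖Q₀‖ (C / (1 - M.γ)), le_max_of_le_left (norm_nonneg _), ?_, fun s k =>
      le_max_of_le_left ((norm_le_pi_norm (Q₀ s) k).trans (norm_le_pi_norm Q₀ s))⟩
    have := (div_le_iff₀ hγ1).1 (le_max_right ‖Q₀‖ (C / (1 - M.γ)))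
    linarith
  set Q : ℕ → Ω → S → B → ℝ := sasQ M.γ D α Q₀
  have hα : ∀ᵐ ω ∂P, ∀ t, 0 ≤ α t ω ∧ α t ω ≤ 1 := by
    filter_upwards [ae_all_iff.2 hα_range] with ω hω t using ⟨(hω t).1, (hω t).2.le⟩
  have hr : ∀ᵐ ω ∂P, ∀ t, |D.reward t ω| ≤ C := ae_all_iff.2 hC
  have hQK : ∀ᵐ ω ∂P, ∀ t s k, |Q t ω s k| ≤ K := by
    filter_upwards [hα, hr] with ω h1 h2 using abs_sasQ_le hγ hK0 hCK hQ₀ h2 h1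
  have hQm : ∀ t s k, Measurable[ℱ t] fun ω => Q t ω s k := measurable_sasQ hD hα_meas M.γ Q₀
  set h : ℕ → Ω → ℝ := fun t ω => M.qOp (Q t ω) (D.state t ω) (D.act t ω)
  set w : ℕ → Ω → ℝ := fun t => D.target M.γ t (Q t) - h t
  have hhm : ∀ t, Measurable[ℱ t] (h t) := fun t => hD.measurable_qOp_current (hQm t)
  have hTm : ∀ t, Measurable[ℱ (t + 1)] (D.target M.γ t (Q t)) := fun t =>
    hD.measurable_target fun s k => (hQm t s k).mono (ℱ.mono t.le_succ) le_rfl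
  have hTK : ∀ t, ∀ᵐ ω ∂P, |D.target M.γ t (Q t) ω| ≤ K := fun t => by
    filter_upwards [hr, hQK] with ω h1 h2 using abs_target_le hγ hK0 hCK (h1 t) (h2 t)
  have hTi : ∀ t, Integrable (D.target M.γ t (Q t)) P := fun t =>
    integrable_of_ae_abs_le ((hTm t).mono (ℱ.le _) le_rfl) (hTK t)
  have hcond : ∀ t, P[D.target M.γ t (Q t) | ℱ t] =ᵐ[P] h t := fun t =>
    hD.condExp_target (hQm t) hK0 (by filter_upwards [hQK] with ω hω using hω t)
  -- The conditional mean inherits the bound of the sampled backup.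
  have hhK : ∀ t, ∀ᵐ ω ∂P, |h t ω| ≤ K := fun t => by
    filter_upwards [hcond t, ae_bdd_abs_condExp_of_ae_bdd_abs (m := ℱ t) (hTK t)]
      with ω h1 h2
    rwa [h1] at h2
  have hhi : ∀ t, Integrable (h t) P := fun t =>
    integrable_of_ae_abs_le ((hhm t).mono (ℱ.le _) le_rfl) (hhK t)
  have hw0 : ∀ t, P[w t | ℱ t] =ᵐ[P] 0 := fun t => by
    filter_upwards [condExp_sub (hTi t) (hhi t) (ℱ t), hcond t] with ω h1 h2
    rw [h1, Pi.sub_apply, h2,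
      condExp_of_stronglyMeasurable (ℱ.le t) (hhm t).stronglyMeasurable (hhi t)]
    simp
  have hwK : ∀ t, ∀ᵐ ω ∂P, |w t ω| ≤ K + K := fun t => by
    filter_upwards [hTK t, hhK t] with ω h1 h2 using (abs_sub _ _).trans (add_le_add h1 h2)
  have hnoise : ∀ s k, ∀ᵐ ω ∂P, ∃ l, Tendsto (fun n =>
      ∑ t ∈ Finset.range n, pairRate D α s k t ω * w t ω) atTop (𝓝 l) := fun s k =>
    ae_exists_tendsto_sum_mul_of_summable_sq (measurable_pairRate hD hα_meas s k)
      (fun t => (hTm t).sub ((hhm t).mono (ℱ.mono t.le_succ) le_rfl)) hwK hw0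
      (fun t => by
        filter_upwards [hα] with ω hω
        obtain ⟨h0, h1⟩ := pairRate_mem (D := D) (hω t) s k
        rwa [abs_of_nonneg h0])
      (hα_sq s k)
  filter_upwards [hα, hQK, ae_all_iff.2 fun s => ae_all_iff.2 (hnoise s),
    ae_all_iff.2 fun s => ae_all_iff.2 (hα_sum s)] with ω h1 h2 h3 h4 s k
  have hfix : ∀ s k, M.qOp M.optQ s k = M.optQ s k := fun s k => by rw [M.qOp_optQ]
  have := tendsto_zero_of_contraction_add_noise (I := S × B)
    (a := fun t i => pairRate D α i.1 i.2 t ω) (x := fun t i => Q t ω i.1 i.2 - M.optQ i.1 i.2)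
    (G := fun t i => M.qOp (Q t ω) i.1 i.2 - M.optQ i.1 i.2) (w := fun t _ => w t ω)
    (K := K + ‖M.optQ‖) hγ M.γ_lt_one (fun t i => pairRate_mem (h1 t) i.1 i.2)
    (fun i => h4 i.1 i.2)
    (fun t i => by
      simp only [Q, sasQ_succ]
      -- The noise `w` belongs to the visited pair only; at any other pair the rate 0 makes its
      -- value irrelevant.
      by_cases hi : i.1 = D.state t ω ∧ i.2 = D.act t ω
      · simp only [w, h, Q, Pi.sub_apply, ← hi.1, ← hi.2]
        ring
      · simp [pairRate, hi])
    (fun t c hc hx i => by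
      have := M.abs_qOp_sub_le hc (fun s k => hx (s, k)) i.1 i.2
      rwa [hfix] at this)
    (fun i => h3 i.1 i.2)
    (fun t i => (abs_sub _ _).trans (add_le_add (h2 t i.1 i.2)
      ((norm_le_pi_norm (M.optQ i.1) i.2).trans (norm_le_pi_norm M.optQ i.1))))
    (s, k)
  simpa using this.add_const (M.optQ s k)
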